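/- Random $(2+p)$-SAT. Fix a real $p\in[0,1]$. A clause of length $k$ over $n$ Boolean variables is a disjunction of $k$ literals on $k$ distinct variables. A random instance $\Phi$ of $(2+p)$-SAT with $n$ variables and $cn$ clauses (constraint density $c$) consists of $\lfloor pcn\rfloor$ clauses of length $3$ and $\lfloor(1-p)cn\rfloor$ clauses of length $2$, all chosen independently, uniformly at random and with repetition among the clauses of their length (a negative number of clauses is read as $0$); its law is denoted $\Pr_{n,c}$. "W.h.p." means with probability tending to $1$ as $n\to\infty$. The constraints of $(2+p)$-SAT are the clauses of length $2$ (if $p<1$) and of length $3$ (if $p>0$). The spine $\mathrm{Spine}(\Phi)$ is the set of the variables $x$ for which there are a satisfiable subformula $\Xi\subseteq\Phi$ and a constraint $C$ in which $x$ occurs such that $\Xi\wedge C$ is unsatisfiable. $(2+p)$-SAT has a first-order phase transition if there exists $\eta>0$ such that, for every sequence $c=c(n)$ of real constraint densities, $$\lim_{n\to\infty}\Pr_{n,c(n)}[\Phi\text{ is satisfiable}]=0\ \Longrightarrow\ \lim_{n\to\infty}\Pr_{n,c(n)}\Big[\tfrac{|\mathrm{Spine}(\Phi)|}{n}\ge\eta\Big]=1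 .$$ Theorem. Let $p\in[0,1]$ be such that there exist $\varepsilon>0$ and a real $c$ with $c\,(1-p)<1-\varepsilon$ (that is, $c<\frac{1-\varepsilon}{1-p}$ if $p<1$; for $p=1$ and $\varepsilon<1$ there is no restriction on $c$) such that random instances of $(2+p)$-SAT with $n$ variables and $cn$ clauses are w.h.p. unsatisfiable. Then $(2+p)$-SAT has a first-order phase transition. -/

import Mathlib

open Filter Topology

namespace TwoPlusPSat

/-- A literal over `n` Boolean variables: `(x, true)` is `x` and `(x, false)` is its negation. -/
abbrev Literal (n : ℕ) := Fin n × Bool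

/-- A clause is a finite set of literals, read as their disjunction. -/
abbrev Clause (n : ℕ) := Finset (Literal n)

/-- A CNF formula is a finite set of clauses, read as their conjunction. -/
abbrev Formula (n : ℕ) := Finset (Clause n)

/-- The set of variables that occur in a clause. -/
def clauseVars {n : ℕ} (C : Clause n) : Finset (Fin n) := C.image Prod.fst

/-- Clauses of length `k`: `k` literals on `k` distinct variables. -/
def IsKClause {n : ℕ} (k : ℕ) (C : Clause n) : Prop :=
  C.card = k ∧ (clauseVars C).card = k

/-- Some truth assignment makes at least one literal of every clause true. -/
def Satisfiable {n : ℕ} (F : Formula n) : Prop :=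
  ∃ σ : Fin n → Bool, ∀ C ∈ F, ∃ l ∈ C, σ l.1 = l.2

/-- The type of clauses of length `k` over `n` variables; it has `2 ^ k * n.choose k` elements. -/
abbrev KClause (n k : ℕ) := {C : Clause n // IsKClause k C}

/-- The sample space: `m₃` clauses of length 3 and `m₂` clauses of length 2, each chosen from all
the clauses of its length over `n` variables, with repetition allowed. -/
abbrev Sample (n m₃ m₂ : ℕ) := (Fin m₃ → KClause n 3) × (Fin m₂ → KClause n 2)

/-- The formula that consists of all the chosen clauses. -/
def sampleFormula {n m₃ m₂ : ℕ} (ω : Sample n m₃ m₂) : Formula n :=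
  (Finset.univ.image fun i => (ω.1 i : Clause n)) ∪
    (Finset.univ.image fun i => (ω.2 i : Clause n))

/-- The probability that a random instance of (2+p)-SAT with `n` variables and `c * n` clauses has
the property `E`. The instance consists of `⌊p * c * n⌋` clauses of length 3 and
`⌊(1 - p) * c * n⌋` clauses of length 2, chosen independently and uniformly; that is, the sample
space carries the uniform distribution. -/
noncomputable def prob (p c : ℝ) (n : ℕ) (E : Formula n → Prop) : ℝ :=
  (Nat.card {ω : Sample n ⌊p * c * n⌋₊ ⌊(1 - p) * c * n⌋₊ // E (sampleFormula ω)} : ℝ) /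
    (Nat.card (Sample n ⌊p * c * n⌋₊ ⌊(1 - p) * c * n⌋₊) : ℝ)

/-- The constraints of (2+p)-SAT, that is, the clauses whose type has positive weight in the model:
clauses of length 2 when `p < 1` and clauses of length 3 when `0 < p`. -/
def IsConstraint (p : ℝ) {n : ℕ} (C : Clause n) : Prop :=
  (p < 1 ∧ IsKClause 2 C) ∨ (0 < p ∧ IsKClause 3 C)

/-- The spine of `Φ`: the variables `x` for which there are a satisfiable subformula `Ξ` of `Φ` and
a constraint `C` of (2+p)-SAT containing `x` such that `Ξ ∧ C` is unsatisfiable. -/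
def spine (p : ℝ) {n : ℕ} (Φ : Formula n) : Set (Fin n) :=
  {x | ∃ Ξ : Formula n, Ξ ⊆ Φ ∧ Satisfiable Ξ ∧
    ∃ C : Clause n, IsConstraint p C ∧ x ∈ clauseVars C ∧ ¬ Satisfiable (insert C Ξ)}

/-- (2+p)-SAT has a first-order phase transition: there is `η > 0` such that, for every sequence
`c n` of constraint densities along which random instances are unsatisfiable w.h.p., the spine
contains w.h.p. at least a fraction `η` of the variables. -/
def HasFirstOrderPhaseTransition (p : ℝ) : Prop :=
  ∃ η : ℝ, 0 < η ∧ ∀ c : ℕ → ℝ,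
    Tendsto (fun n => prob p (c n) n Satisfiable) atTop (𝓝 0) →
      Tendsto (fun n => prob p (c n) n fun Φ => η ≤ ((spine p Φ).ncard : ℝ) / (n : ℝ))
        atTop (𝓝 1)

end TwoPlusPSat

/-! An unsatisfiable instance contains a minimally unsatisfiable subformula `F`. Every variable of
`F` lies in the spine: delete from `F` a clause that contains it and use that clause as the
constraint. So it suffices that w.h.p. no such `F` has at most n/K variables, for a suitable
constant K.

If `F` has v variables, then it has at least v + 1 clauses (Tarsi's lemma,
`MinimalUnsat.card_formulaVars_lt`) and no pure literal, so between v + 1 and 2v of its clauses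
contain all 2v literals and no others (`MinimalUnsat.exists_cover`). Let ρ < 1 exceed the density of
2-clauses, and let ρ e^θ < 1 with θ > 0. For Kv ≤ n, the expected number of such covers by a clauses
of length 2 and b of length 3 is at most (Kv/n)(ρ e^θ)^v (`first_moment_term_le`): one clause more
than variables yields the factor 1/n, and sparse 2-clauses yield the geometric decay. Summing over
a, b and v gives O(1/n).

This needs 2-clause density below 1, while the sequence d(n) is arbitrary. Hence the estimate is
applied at density min(d(n), c), where instances are still unsatisfiable w.h.p.; adding clauses only
enlarges the spine. -/

namespace TwoPlusPSat

/-! ### Minimally unsatisfiable formulas and the spine -/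

/-- The set of variables that occur in a formula. -/
def formulaVars {n : ℕ} (F : Formula n) : Finset (Fin n) := F.biUnion clauseVars

/-- An unsatisfiable formula all of whose proper subformulas are satisfiable. -/
def MinimalUnsat {n : ℕ} (F : Formula n) : Prop :=
  ¬ Satisfiable F ∧ ∀ G, G ⊂ F → Satisfiable G

theorem exists_minimalUnsat_subset {n : ℕ} {F : Formula n} (hF : ¬ Satisfiable F) :
    ∃ G ⊆ F, MinimalUnsat G := by
  induction F using Finset.strongInduction with
  | H F ih =>
    by_cases h : ∃ G, G ⊂ F ∧ ¬ Satisfiable G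
    · obtain ⟨G, hGF, hG⟩ := h
      obtain ⟨H, hHG, hH⟩ := ih G hGF hG
      exact ⟨H, hHG.trans hGF.subset, hH⟩
    · push Not at h
      exact ⟨F, subset_rfl, hF, h⟩

theorem mem_clauseVars_of_mem {n : ℕ} {C : Clause n} {l : Literal n} (h : l ∈ C) :
    l.1 ∈ clauseVars C :=
  Finset.mem_image_of_mem _ h

theorem mem_formulaVars_of_mem {n : ℕ} {F : Formula n} {C : Clause n} {l : Literal n}
    (hC : C ∈ F) (h : l ∈ C) : l.1 ∈ formulaVars F :=
  Finset.mem_biUnion.2 ⟨C, hC, mem_clauseVars_of_mem h⟩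

/-- A minimally unsatisfiable formula has no pure literals. -/
theorem MinimalUnsat.exists_mem {n : ℕ} {F : Formula n} (hF : MinimalUnsat F) {x : Fin n}
    (hx : x ∈ formulaVars F) (b : Bool) : ∃ C ∈ F, (x, b) ∈ C := by
  by_contra! h
  obtain ⟨C₀, hC₀, hxC₀⟩ := Finset.mem_biUnion.1 hx
  -- If `(x, b)` never occurs, setting `x` to `!b` satisfies every clause containing `x` and leaves
  -- the others untouched.
  obtain ⟨σ, hσ⟩ := hF.2 (F.filter fun C => x ∉ clauseVars C)
    (Finset.filter_ssubset.2 ⟨C₀, hC₀, not_not.2 hxC₀⟩)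
  refine hF.1 ⟨Function.update σ x (!b), fun C hC => ?_⟩
  by_cases hxC : x ∈ clauseVars C
  · obtain ⟨⟨y, b'⟩, hl, rfl⟩ := Finset.mem_image.1 hxC
    refine ⟨_, hl, ?_⟩
    have : b' ≠ b := by
      rintro rfl
      exact h C hC hl
    simpa using (Bool.eq_not.2 this).symm
  · obtain ⟨l, hl, hl'⟩ := hσ C (Finset.mem_filter.2 ⟨hC, hxC⟩)
    refine ⟨l, hl, ?_⟩
    rw [Function.update_of_ne, hl']
    rintro rfl
    exact hxC (mem_clauseVars_of_mem hl)

/-- If the clauses of `F` can be matched into variables outside `V`, then any assignment can be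
changed outside `V` so as to satisfy `F`. -/
theorem exists_assignment_of_hall {n : ℕ} (F : Formula n) (V : Finset (Fin n))
    (hall : ∀ G ⊆ F, G.card ≤ (formulaVars G \ V).card) (σ : Fin n → Bool) :
    ∃ τ : Fin n → Bool, (∀ x ∈ V, τ x = σ x) ∧ ∀ C ∈ F, ∃ l ∈ C, τ l.1 = l.2 := by
  obtain ⟨f, hf, hfm⟩ := (Finset.all_card_le_biUnion_card_iff_exists_injective
    (fun C : F => clauseVars (C : Clause n) \ V)).1 (by
      intro s
      have := hall (s.map (Function.Embedding.subtype _)) (by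
        intro C hC
        obtain ⟨D, -, rfl⟩ := Finset.mem_map.1 hC
        exact D.2)
      rw [Finset.card_map] at this
      refine this.trans (Finset.card_le_card ?_)
      intro x hx
      simp only [formulaVars, Finset.mem_sdiff, Finset.mem_biUnion, Finset.mem_map,
        Function.Embedding.subtype_apply] at hx ⊢
      obtain ⟨⟨C, ⟨D, hD, rfl⟩, hxC⟩, hxV⟩ := hx
      exact ⟨D, hD, hxC, hxV⟩)
  have hlit : ∀ C : F, ∃ l ∈ (C : Clause n), l.1 = f C := fun C =>
    Finset.mem_image.1 (Finset.mem_sdiff.1 (hfm C)).1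
  choose lit hlit hlitf using hlit
  classical
  refine ⟨fun x => if h : ∃ C, f C = x then (lit h.choose).2 else σ x, fun x hx => ?_,
    fun C hC => ⟨lit ⟨C, hC⟩, hlit _, ?_⟩⟩
  · refine dif_neg ?_
    rintro ⟨C, rfl⟩
    exact (Finset.mem_sdiff.1 (hfm C)).2 hx
  · have h : ∃ D, f D = (lit ⟨C, hC⟩).1 := ⟨_, (hlitf _).symm⟩
    refine (dif_pos h).trans ?_
    -- Injectivity of the matching identifies the chosen clause with `C`, so clauses make no
    -- conflicting demands on a variable.
    rw [hf (h.choose_spec.trans (hlitf _))]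

/-- Tarsi's lemma: a minimally unsatisfiable formula has more clauses than variables. -/
theorem MinimalUnsat.card_formulaVars_lt {n : ℕ} {F : Formula n} (hF : MinimalUnsat F) :
    (formulaVars F).card < F.card := by
  by_contra! hle
  have hne : (∅ : Formula n) ≠ F := by
    rintro rfl
    exact hF.1 ⟨fun _ => true, by simp⟩
  -- Take `G` of maximal deficiency (clauses minus variables). If the maximum is attained at `F`, it
  -- is at most 0, so `∅` attains it as well; hence `G` can be a proper subformula.
  obtain ⟨G, hGF, hne, hmax⟩ : ∃ G ⊆ F, G ≠ F ∧ ∀ H ⊆ F,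
      (H.card : ℤ) - (formulaVars H).card ≤ G.card - (formulaVars G).card := by
    obtain ⟨G, hG, hmax⟩ := Finset.exists_max_image F.powerset
      (fun G => (G.card : ℤ) - (formulaVars G).card) ⟨∅, by simp⟩
    simp only [Finset.mem_powerset] at hG hmax
    by_cases hGF : G = F
    · refine ⟨∅, by simp, hne, fun H hH => (hmax H hH).trans ?_⟩
      simp only [hGF, formulaVars, Finset.card_empty, Finset.biUnion_empty]
      simp only [formulaVars] at hle
      omega
    · exact ⟨G, hG, hGF, hmax⟩
  obtain ⟨σ, hσ⟩ := hF.2 G (Finset.ssubset_iff_subset_ne.2 ⟨hGF, hne⟩)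
  -- Maximality of `G` against `G ∪ H` is exactly Hall's condition for matching `F \ G` into
  -- variables outside `G`.
  obtain ⟨τ, hτ, hτ'⟩ := exists_assignment_of_hall (F \ G) (formulaVars G) (fun H hH => by
    have h1 := hmax (G ∪ H) (Finset.union_subset hGF (hH.trans Finset.sdiff_subset))
    have h2 : formulaVars (G ∪ H) = formulaVars G ∪ formulaVars H := Finset.union_biUnion
    have h3 : Disjoint G H := (Finset.disjoint_sdiff (s := G) (t := F)).mono_right hH
    rw [Finset.card_union_of_disjoint h3, h2, Finset.union_comm (formulaVars G),
      ← Finset.card_sdiff_add_card] at h1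
    push_cast at h1
    omega) σ
  refine hF.1 ⟨τ, fun C hC => ?_⟩
  by_cases hCG : C ∈ G
  · obtain ⟨l, hl, hl'⟩ := hσ C hCG
    exact ⟨l, hl, (hτ _ (mem_formulaVars_of_mem hCG hl)).trans hl'⟩
  · exact hτ' C (Finset.mem_sdiff.2 ⟨hC, hCG⟩)

/-- The variables of a minimally unsatisfiable subformula belong to the spine. -/
theorem MinimalUnsat.formulaVars_subset_spine {n : ℕ} {p : ℝ} {F Φ : Formula n}
    (hF : MinimalUnsat F) (hFΦ : F ⊆ Φ) (hc : ∀ C ∈ Φ, IsConstraint p C) :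
    (formulaVars F : Set (Fin n)) ⊆ spine p Φ := by
  intro x hx
  obtain ⟨C, hC, hxC⟩ := Finset.mem_biUnion.1 hx
  refine ⟨F.erase C, (Finset.erase_subset _ _).trans hFΦ, hF.2 _ (Finset.erase_ssubset hC), C,
    hc C (hFΦ hC), hxC, ?_⟩
  rw [Finset.insert_erase hC]
  exact hF.1

theorem spine_mono {n : ℕ} (p : ℝ) {Φ Ψ : Formula n} (h : Φ ⊆ Ψ) : spine p Φ ⊆ spine p Ψ :=
  fun _ ⟨Ξ, hΞ, h'⟩ => ⟨Ξ, hΞ.trans h, h'⟩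

/-- A minimally unsatisfiable formula with `v` variables has a subformula of between `v + 1` and
`2 * v` clauses in which exactly the `2 * v` literals over these variables occur. -/
theorem MinimalUnsat.exists_cover {n : ℕ} {F : Formula n} (hF : MinimalUnsat F)
    (hV : (formulaVars F).Nonempty) :
    ∃ G ⊆ F, G.biUnion id = formulaVars F ×ˢ Finset.univ ∧
      (formulaVars F).card + 1 ≤ G.card ∧ G.card ≤ 2 * (formulaVars F).card := by
  have hex : ∀ l : Literal n, ∃ C, l.1 ∈ formulaVars F → C ∈ F ∧ l ∈ C := by
    intro l
    by_cases h : l.1 ∈ formulaVars F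
    · obtain ⟨C, hC⟩ := hF.exists_mem h l.2
      exact ⟨C, fun _ => hC⟩
    · exact ⟨∅, fun h' => (h h').elim⟩
  choose c hc using hex
  set T : Finset (Literal n) := formulaVars F ×ˢ Finset.univ with hT
  have hTmem : ∀ l, l ∈ T ↔ l.1 ∈ formulaVars F := by simp [hT]
  have hTcard : T.card = 2 * (formulaVars F).card := by simp [hT, mul_comm]
  have hsub : T.image c ⊆ F := by
    intro C hC
    obtain ⟨l, hl, rfl⟩ := Finset.mem_image.1 hC
    exact (hc l ((hTmem l).1 hl)).1
  have hcard : (T.image c).card ≤ 2 * (formulaVars F).card := hTcard ▸ Finset.card_image_le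
  -- One clause per literal may give too few clauses; Tarsi's lemma leaves room in `F` to pad up to
  -- v + 1, which is at most 2v since v ≥ 1.
  obtain ⟨G, hG, hGF, hGc⟩ := Finset.exists_subsuperset_card_eq hsub
    (le_max_left _ ((formulaVars F).card + 1))
    (max_le (Finset.card_le_card hsub) hF.card_formulaVars_lt)
  have := hV.card_pos
  refine ⟨G, hGF, ?_, by omega, by omega⟩
  ext l
  rw [hTmem, Finset.mem_biUnion]
  constructor
  · rintro ⟨C, hC, hl⟩
    exact mem_formulaVars_of_mem (hGF hC) hl
  · intro hl
    exact ⟨c l, hG (Finset.mem_image_of_mem _ ((hTmem l).2 hl)), (hc l hl).2⟩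

/-! ### Covers inside a sample -/

/-- The clauses with indices in `B` and `A` together contain exactly the literals in `T`. -/
def Covers {n m₃ m₂ : ℕ} (ω : Sample n m₃ m₂) (B : Finset (Fin m₃)) (A : Finset (Fin m₂))
    (T : Finset (Literal n)) : Prop :=
  (B.biUnion fun i => (ω.1 i : Clause n)) ∪ (A.biUnion fun i => (ω.2 i : Clause n)) = T

/-- Clauses may be drawn repeatedly, so one index is selected for each clause of `G`; this keeps the
count of indices equal to the count of clauses. -/
theorem exists_covers {n m₃ m₂ : ℕ} {ω : Sample n m₃ m₂} {G : Formula n}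
    (hG : G ⊆ sampleFormula ω) :
    ∃ (B : Finset (Fin m₃)) (A : Finset (Fin m₂)), B.card + A.card = G.card ∧
      Covers ω B A (G.biUnion id) := by
  classical
  have h3 : G ∩ (Finset.univ.image fun i => (ω.1 i : Clause n)) ⊆
    (Finset.univ.image fun i => (ω.1 i : Clause n)) := Finset.inter_subset_right
  have h2 : G \ (Finset.univ.image fun i => (ω.1 i : Clause n)) ⊆
      (Finset.univ.image fun i => (ω.2 i : Clause n)) := by
    intro C hC
    obtain ⟨hC, hC'⟩ := Finset.mem_sdiff.1 hC
    exact (Finset.mem_union.1 (hG hC)).resolve_left hC'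
  obtain ⟨B, -, hBi, hB⟩ :=
    Finset.exists_subset_injOn_image_eq_of_surjOn (f := fun i => (ω.1 i : Clause n))
      Set.univ _ (fun C hC => by simpa using Finset.mem_image.1 (h3 hC))
  obtain ⟨A, -, hAi, hA⟩ :=
    Finset.exists_subset_injOn_image_eq_of_surjOn (f := fun i => (ω.2 i : Clause n))
      Set.univ _ (fun C hC => by simpa using Finset.mem_image.1 (h2 hC))
  refine ⟨B, A, ?_, ?_⟩
  · rw [← Finset.card_image_of_injOn hBi, ← Finset.card_image_of_injOn hAi, hB, hA,
      Finset.card_inter_add_card_sdiff]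
  · have hB' := congrArg (fun s : Formula n => s.biUnion id) hB
    have hA' := congrArg (fun s : Formula n => s.biUnion id) hA
    simp only [Finset.image_biUnion, id] at hA' hB'
    rw [Covers, hB', hA', ← Finset.union_biUnion, Finset.union_comm,
      Finset.sdiff_union_inter]

/-- A sample that has an unsatisfiable subformula with few variables covers a small set of
variables. -/
theorem exists_covers_of_minimalUnsat {n m₃ m₂ : ℕ} {ω : Sample n m₃ m₂} {F : Formula n}
    (hF : MinimalUnsat F) (hFω : F ⊆ sampleFormula ω) :
    ∃ (V : Finset (Fin n)) (B : Finset (Fin m₃)) (A : Finset (Fin m₂)), V = formulaVars F ∧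
      V.card + 1 ≤ B.card + A.card ∧ B.card + A.card ≤ 2 * V.card ∧
      Covers ω B A (V ×ˢ Finset.univ) := by
  have hV : (formulaVars F).Nonempty := by
    obtain ⟨C, hC⟩ : F.Nonempty := by
      rw [Finset.nonempty_iff_ne_empty]
      rintro rfl
      exact hF.1 ⟨fun _ => true, by simp⟩
    have hcard : C.Nonempty := by
      rw [← Finset.card_pos]
      rcases Finset.mem_union.1 (hFω hC) with h | h
      · obtain ⟨i, -, rfl⟩ := Finset.mem_image.1 h
        have := (ω.1 i).2.1
        omega
      · obtain ⟨i, -, rfl⟩ := Finset.mem_image.1 h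
        have := (ω.2 i).2.1
        omega
    obtain ⟨l, hl⟩ := hcard
    exact ⟨_, mem_formulaVars_of_mem hC hl⟩
  obtain ⟨G, hGF, hGu, h1, h2⟩ := hF.exists_cover hV
  obtain ⟨B, A, hBA, hcov⟩ := exists_covers (hGF.trans hFω)
  exact ⟨_, B, A, rfl, by omega, by omega, hGu ▸ hcov⟩

end TwoPlusPSat

/-! ### Counting the samples that cover a given set of literals -/

/-- An upper bound for the number of functions with a given image: choose a section of the
function, then its remaining values. -/
theorem card_image_eq_le {ι α : Type*} [Fintype ι] [DecidableEq ι] [DecidableEq α]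
    (T : Finset α) :
    Nat.card {f : ι → α // Finset.univ.image f = T} ≤
      (Fintype.card ι).descFactorial T.card * T.card ^ (Fintype.card ι - T.card) := by
  classical
  -- `P g` prescribes the value at each position hit by the section `g` and allows any element of
  -- `T` elsewhere.
  let P : (T ↪ ι) → ι → Finset α := fun g i =>
    if h : ∃ t, g t = i then {(h.choose : α)} else T
  have hP : ∀ g, (Fintype.piFinset (P g)).card = T.card ^ (Fintype.card ι - T.card) := by
    intro g
    rw [Fintype.card_piFinset]
    have : ∀ i, (P g i).card = if i ∈ Finset.univ.map g then 1 else T.card := by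
      intro i
      simp only [P, Finset.mem_map, Finset.mem_univ, true_and]
      split_ifs <;> simp
    simp only [this]
    rw [Finset.prod_ite, Finset.prod_const_one, one_mul, Finset.prod_const]
    congr 1
    rw [Finset.filter_not, Finset.filter_mem_eq_inter, Finset.univ_inter,
      Finset.card_sdiff_of_subset (Finset.subset_univ _), Finset.card_map]
    simp
  have hsub : ((Finset.univ : Finset (T ↪ ι)).biUnion fun g => Fintype.piFinset (P g)).card ≤
      (Fintype.card ι).descFactorial T.card * T.card ^ (Fintype.card ι - T.card) := by
    refine Finset.card_biUnion_le.trans ?_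
    simp only [hP]
    simp
  refine le_trans ?_ hsub
  rw [← Nat.card_eq_finsetCard]
  have hmem : ∀ f : {f : ι → α // Finset.univ.image f = T}, f.1 ∈
      (Finset.univ : Finset (T ↪ ι)).biUnion (fun g => Fintype.piFinset (P g)) := by
    rintro ⟨f, hf⟩
    have hsec : ∀ t : T, ∃ i, f i = t := fun t => by
      simpa using (Finset.ext_iff.1 hf t).2 t.2
    choose g hg using hsec
    have hginj : Function.Injective g := fun s t h => Subtype.ext (by rw [← hg s, ← hg t, h])
    refine Finset.mem_biUnion.2 ⟨⟨g, hginj⟩, Finset.mem_univ _, Fintype.mem_piFinset.2 fun i => ?_⟩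
    simp only [P]
    split_ifs with h
    · have h' := h.choose_spec
      simp only [Function.Embedding.coeFn_mk] at h'
      rw [Finset.mem_singleton, ← hg, h']
    · exact hf ▸ Finset.mem_image_of_mem _ (Finset.mem_univ _)
  exact Nat.card_le_card_of_injective (fun f => (⟨f.1, hmem f⟩ : {x // x ∈ _}))
    (fun f g h => Subtype.ext (by simpa using h))

namespace TwoPlusPSat

/-- An enumeration of the literals of a clause of length `k`. -/
noncomputable def KClause.lit {n k : ℕ} (C : KClause n k) (j : Fin k) : Literal n :=
  (Finset.equivFinOfCardEq C.2.1).symm j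

theorem KClause.lit_injective {n k : ℕ} (C : KClause n k) : Function.Injective C.lit :=
  Subtype.val_injective.comp (Equiv.injective _)

theorem KClause.image_lit_perm {n k : ℕ} (C : KClause n k) (σ : Equiv.Perm (Fin k)) :
    Finset.univ.image (fun j => C.lit (σ j)) = C.1 := by
  ext l
  simp only [Finset.mem_image, Finset.mem_univ, true_and]
  constructor
  · rintro ⟨j, rfl⟩
    exact ((Finset.equivFinOfCardEq C.2.1).symm (σ j)).2
  · intro hl
    refine ⟨σ.symm (Finset.equivFinOfCardEq C.2.1 ⟨l, hl⟩), ?_⟩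
    simp [KClause.lit]

/-- An ordered list of literals determines both the clause and the ordering. This is the source of
the gains 3! = 6 and 2! = 2 per clause in `card_covers_mul_le`. -/
theorem KClause.lit_perm_injective {n k : ℕ} {C D : KClause n k} {σ τ : Equiv.Perm (Fin k)}
    (h : ∀ j, C.lit (σ j) = D.lit (τ j)) : C = D ∧ σ = τ := by
  have hCD : C = D := by
    refine Subtype.ext ?_
    rw [← C.image_lit_perm σ, ← D.image_lit_perm τ]
    simp only [h]
  subst hCD
  exact ⟨rfl, Equiv.ext fun j => C.lit_injective (h j)⟩

theorem two_pow_mul_choose_le (n k : ℕ) : 2 ^ k * n.choose k ≤ Nat.card (KClause n k) := by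
  classical
  have hcard : Nat.card (Σ s : Finset.powersetCard k (Finset.univ : Finset (Fin n)),
      (s.1 → Bool)) = 2 ^ k * n.choose k := by
    rw [Nat.card_eq_fintype_card, Fintype.card_sigma,
      Finset.sum_congr rfl (g := fun _ => 2 ^ k) (fun s _ => by
        have := (Finset.mem_powersetCard.1 s.2).2
        simp [this])]
    simp [mul_comm]
  rw [← hcard]
  let c : (Σ s : Finset.powersetCard k (Finset.univ : Finset (Fin n)),
      (s.1 → Bool)) → Clause n := fun q =>
    q.1.1.attach.image fun x : q.1.1 => ((x.1, q.2 x) : Literal n)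
  have hmem : ∀ q x b, (x, b) ∈ c q ↔ ∃ h : x ∈ q.1.1, q.2 ⟨x, h⟩ = b := by
    intro q x b
    simp only [c, Finset.mem_image, Finset.mem_attach, true_and, Prod.mk.injEq]
    constructor
    · rintro ⟨y, rfl, rfl⟩
      exact ⟨y.2, rfl⟩
    · rintro ⟨h, rfl⟩
      exact ⟨⟨x, h⟩, rfl, rfl⟩
  have hvars : ∀ q, clauseVars (c q) = q.1 := by
    intro q
    ext x
    simp only [clauseVars, Finset.mem_image, Prod.exists, exists_and_right, exists_eq_right, hmem]
    exact ⟨fun ⟨_, h, _⟩ => h, fun h => ⟨q.2 ⟨x, h⟩, h, rfl⟩⟩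
  have hk : ∀ q, IsKClause k (c q) := by
    intro q
    have hq := (Finset.mem_powersetCard.1 q.1.2).2
    refine ⟨?_, by rw [hvars, hq]⟩
    rw [Finset.card_image_of_injective _ (fun x y h => Subtype.ext (Prod.ext_iff.1 h).1)]
    simp [hq]
  refine Nat.card_le_card_of_injective (fun q => (⟨c q, hk q⟩ : KClause n k)) ?_
  intro q r h
  have h : c q = c r := congrArg Subtype.val h
  obtain ⟨s, f⟩ := q
  obtain ⟨t, g⟩ := r
  have hst : s = t := Subtype.ext (by rw [← hvars ⟨s, f⟩, ← hvars ⟨t, g⟩, h])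
  subst hst
  congr 1
  funext x
  have := (hmem ⟨s, f⟩ x (f x)).2 ⟨x.2, rfl⟩
  rw [h, hmem] at this
  exact this.2.symm

/-- The number of samples whose clauses with indices in `B` and `A` contain exactly the literals
in `T`, in terms of the number of functions with image `T`. -/
theorem card_covers_mul_le {n m₃ m₂ : ℕ} (B : Finset (Fin m₃)) (A : Finset (Fin m₂))
    (T : Finset (Literal n)) :
    Nat.card {ω : Sample n m₃ m₂ // Covers ω B A T} * (6 ^ B.card * 2 ^ A.card) ≤
      ((3 * B.card + 2 * A.card).descFactorial T.card *
        T.card ^ (3 * B.card + 2 * A.card - T.card)) *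
      (Nat.card (KClause n 3) ^ (m₃ - B.card) * Nat.card (KClause n 2) ^ (m₂ - A.card)) := by
  classical
  have hS := card_image_eq_le (ι := (B × Fin 3) ⊕ (A × Fin 2)) T
  have hι : Fintype.card ((B × Fin 3) ⊕ (A × Fin 2)) = 3 * B.card + 2 * A.card := by
    simp [mul_comm]
  rw [hι] at hS
  refine le_trans ?_ (Nat.mul_le_mul_right _ hS)
  -- Double counting: `X` adds an ordering of each selected clause; `Y` records the literals in the
  -- selected slots and, separately, the unselected clauses. The map reading off this data injects
  -- `X` into `Y`.
  let X := {ω : Sample n m₃ m₂ // Covers ω B A T} ×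
    ((B → Equiv.Perm (Fin 3)) × (A → Equiv.Perm (Fin 2)))
  let Y := {f : (B × Fin 3) ⊕ (A × Fin 2) → Literal n // Finset.univ.image f = T} ×
    (({i : Fin m₃ // i ∉ B} → KClause n 3) × ({i : Fin m₂ // i ∉ A} → KClause n 2))
  have hX : Nat.card X = Nat.card {ω : Sample n m₃ m₂ // Covers ω B A T} *
      (6 ^ B.card * 2 ^ A.card) := by
    simp [X, Fintype.card_perm, Nat.factorial]
  have hY : Nat.card Y = Nat.card {f : (B × Fin 3) ⊕ (A × Fin 2) → Literal n //
      Finset.univ.image f = T} *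
      (Nat.card (KClause n 3) ^ (m₃ - B.card) * Nat.card (KClause n 2) ^ (m₂ - A.card)) := by
    have h3 : Nat.card {i : Fin m₃ // i ∉ B} = m₃ - B.card := by
      rw [Nat.card_eq_fintype_card, Fintype.card_subtype_compl]; simp
    have h2 : Nat.card {i : Fin m₂ // i ∉ A} = m₂ - A.card := by
      rw [Nat.card_eq_fintype_card, Fintype.card_subtype_compl]; simp
    simp only [Y, Nat.card_prod, Nat.card_fun, h3, h2]
  rw [← hX, ← hY]
  let φ : X → (B × Fin 3) ⊕ (A × Fin 2) → Literal n := fun x =>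
    Sum.elim (fun q => (x.1.1.1 q.1).lit (x.2.1 q.1 q.2))
      (fun q => (x.1.1.2 q.1).lit (x.2.2 q.1 q.2))
  have hφ : ∀ x, Finset.univ.image (φ x) = T := by
    intro x
    rw [← x.1.2]
    ext l
    simp only [φ, Finset.mem_image, Finset.mem_univ, true_and, Sum.exists, Prod.exists,
      Sum.elim_inl, Sum.elim_inr, Finset.mem_union, Finset.mem_biUnion, Subtype.exists]
    have h3 : ∀ (i : Fin m₃) (h : i ∈ B), (∃ j, (x.1.1.1 i).lit (x.2.1 ⟨i, h⟩ j) = l) ↔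
        l ∈ (x.1.1.1 i).1 := fun i h => by
      rw [← KClause.image_lit_perm (x.1.1.1 i) (x.2.1 ⟨i, h⟩)]; simp
    have h2 : ∀ (i : Fin m₂) (h : i ∈ A), (∃ j, (x.1.1.2 i).lit (x.2.2 ⟨i, h⟩ j) = l) ↔
        l ∈ (x.1.1.2 i).1 := fun i h => by
      rw [← KClause.image_lit_perm (x.1.1.2 i) (x.2.2 ⟨i, h⟩)]; simp
    simp only [h3, h2, exists_prop]
  refine Nat.card_le_card_of_injective (fun x : X =>
    ((⟨φ x, hφ x⟩, (fun i => x.1.1.1 i, fun i => x.1.1.2 i)) : Y)) ?_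
  rintro ⟨⟨⟨ω₃, ω₂⟩, hω⟩, σ, τ⟩ ⟨⟨⟨ω₃', ω₂'⟩, hω'⟩, σ', τ'⟩ h
  simp only [Prod.mk.injEq, Subtype.mk.injEq, φ, Y] at h
  obtain ⟨hf, h3, h2⟩ := h
  have h3' : ∀ i : B, ω₃ i = ω₃' i ∧ σ i = σ' i := fun i =>
    KClause.lit_perm_injective fun j => congrFun hf (Sum.inl (i, j))
  have h2' : ∀ i : A, ω₂ i = ω₂' i ∧ τ i = τ' i := fun i =>
    KClause.lit_perm_injective fun j => congrFun hf (Sum.inr (i, j))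
  have e3 : ω₃ = ω₃' := funext fun i => if hi : i ∈ B then (h3' ⟨i, hi⟩).1 else
    congrFun h3 ⟨i, hi⟩
  have e2 : ω₂ = ω₂' := funext fun i => if hi : i ∈ A then (h2' ⟨i, hi⟩).1 else
    congrFun h2 ⟨i, hi⟩
  subst e3 e2
  rw [funext fun i => (h3' i).2, funext fun i => (h2' i).2]

/-! ### The first moment estimate -/

open scoped Nat in
theorem factorial_add_le (i j : ℕ) : (i + j)! ≤ 2 ^ (i + j) * (i ! * j !) := by
  rw [← Nat.add_choose_mul_factorial_mul_factorial, mul_assoc]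
  exact Nat.mul_le_mul_right _ (Nat.choose_le_two_pow _ _)

open scoped Nat in
/-- The contribution to the first moment of the sets of `v` variables that are covered by `a`
clauses of length 2 and `b` clauses of length 3. -/
theorem first_moment_term_le {ρ θ D : ℝ} (hρ : 0 < ρ) (hρ1 : ρ ≤ 1) (hθ : 0 < θ) (hD : 1 ≤ D)
    {n v a b : ℕ} (hn : 0 < n) (hlow : v + 1 ≤ b + a) (hhigh : b + a ≤ 2 * v)
    (hK : 1728 * D / (ρ * θ ^ 2) * v ≤ n) :
    (n : ℝ) ^ v / v ! * (1 / (a ! * b !)) * (3 * b + 2 * a).descFactorial (2 * v) *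
      (2 * v : ℝ) ^ (3 * b + 2 * a - 2 * v) * ((ρ / (4 * n)) ^ a * (D / n ^ 2) ^ b) ≤
    1728 * D / (ρ * θ ^ 2) * v / n * (ρ * Real.exp θ) ^ v := by
  obtain ⟨e, he⟩ : ∃ e, b + a = v + 1 + e := ⟨b + a - (v + 1), by omega⟩
  -- `s` = a + 2b - v is the net power of 1/n, and s ≥ 1; `r` counts the literal slots beyond the 2v
  -- needed for a section.
  set s := b + 1 + e with hs
  set r := 3 * b + 2 * a - 2 * v with hr
  have hrs : r + b = 2 * s := by omega
  have hn' : (0 : ℝ) < n := by exact_mod_cast hn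
  have hA : (n : ℝ) ^ v * ((ρ / (4 * n)) ^ a * (D / n ^ 2) ^ b) =
      ρ ^ a * D ^ b / (4 ^ a * n ^ s) := by
    have : (n : ℝ) ^ a * (n ^ 2) ^ b = n ^ v * n ^ s := by
      rw [← pow_mul, ← pow_add, ← pow_add]
      congr 1
      omega
    rw [div_pow, div_pow, mul_pow]
    field_simp
    linear_combination (-1 : ℝ) * this
  have hfac : ((3 * b + 2 * a)! : ℝ) ≤ 2 ^ (v + a) * (v ! * a !) * (6 * v) ^ (s + b) := by
    have h : (3 * b + 2 * a)! ≤ 2 ^ (v + a) * (v ! * a !) * (6 * v) ^ (s + b) := by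
      have h1 : 3 * b + 2 * a = (v + a) + (s + b) := by omega
      rw [h1, ← Nat.factorial_mul_ascFactorial]
      refine Nat.mul_le_mul (factorial_add_le v a) ((Nat.ascFactorial_le_pow_add _ _).trans ?_)
      exact Nat.pow_le_pow_left (by omega) _
    exact_mod_cast h
  have hrb : ((2 * s)! : ℝ) ≤ 4 ^ s * (r ! * b !) := by
    have h : (2 * s)! ≤ (2 ^ 2) ^ s * (r ! * b !) := by
      rw [← pow_mul, ← hrs]
      exact factorial_add_le r b
    exact_mod_cast h
  have hdesc : ((3 * b + 2 * a).descFactorial (2 * v) : ℝ) = (3 * b + 2 * a)! / r ! := by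
    rw [eq_div_iff (by positivity), mul_comm]
    exact_mod_cast Nat.factorial_mul_descFactorial (by omega : 2 * v ≤ 3 * b + 2 * a)
  have hB : (1 / v ! : ℝ) * (1 / (a ! * b !)) * (3 * b + 2 * a).descFactorial (2 * v) ≤
      2 ^ (v + a) * (6 * v) ^ (s + b) * (4 ^ s / (2 * s)!) := by
    have h1 : (1 : ℝ) / (r ! * b !) ≤ 4 ^ s / (2 * s)! := by
      rw [div_le_div_iff₀ (by positivity) (by positivity), one_mul]
      exact hrb
    calc (1 / v ! : ℝ) * (1 / (a ! * b !)) * (3 * b + 2 * a).descFactorial (2 * v)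
        = (3 * b + 2 * a)! / (v ! * a !) * (1 / (r ! * b !)) := by
          rw [hdesc]
          field_simp
      _ ≤ 2 ^ (v + a) * (6 * v) ^ (s + b) * (4 ^ s / (2 * s)!) := by
          refine mul_le_mul ?_ h1 (by positivity) (by positivity)
          rw [div_le_iff₀ (by positivity)]
          linarith
  -- The factor `4 ^ a` cancels the 4 in `ρ / (4 * n)`, so the exponential rate is ρ itself. What
  -- remains is absorbed in the s-th power: 1728 = 2 · 4 · 6³.
  have h2 : (2 : ℝ) ^ (v + a) ≤ 4 ^ a * 2 ^ s := by
    have : (4 : ℝ) ^ a = 2 ^ (2 * a) := by rw [pow_mul]; norm_num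
    rw [this, ← pow_add]
    exact pow_le_pow_right₀ (by norm_num) (by omega)
  have hρa : ρ ^ a ≤ ρ ^ v / ρ ^ s := by
    rw [le_div_iff₀ (by positivity), ← pow_add]
    exact pow_le_pow_of_le_one hρ.le hρ1 (by omega)
  have hDb : D ^ b ≤ D ^ s := pow_le_pow_right₀ hD (by omega)
  -- One term of the exponential series: the factorial is traded for a growth factor e^θ per
  -- variable, at the cost of powers of 1/θ.
  have hexp : (v : ℝ) ^ (2 * s) / (2 * s)! ≤ Real.exp (θ * v) / θ ^ (2 * s) := by
    rw [le_div_iff₀ (by positivity), div_mul_eq_mul_div, ← mul_pow, mul_comm (v : ℝ)]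
    exact Real.pow_div_factorial_le_exp _ (mul_nonneg hθ.le v.cast_nonneg) _
  have hv26 : (2 * v : ℝ) ^ r ≤ (6 * v) ^ r :=
    pow_le_pow_left₀ (by positivity) (by linarith [(Nat.cast_nonneg v : (0 : ℝ) ≤ v)]) _
  set t : ℝ := 1728 * D / (ρ * θ ^ 2) * v / n with ht
  have ht0 : 0 ≤ t := by positivity
  have ht1 : t ≤ 1 := by rwa [ht, div_le_one hn']
  calc _ = (n : ℝ) ^ v * ((ρ / (4 * n)) ^ a * (D / n ^ 2) ^ b) *
        ((1 / v ! : ℝ) * (1 / (a ! * b !)) * (3 * b + 2 * a).descFactorial (2 * v)) *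
        (2 * v : ℝ) ^ r := by ring
    _ ≤ ρ ^ a * D ^ b / (4 ^ a * n ^ s) *
        (2 ^ (v + a) * (6 * v) ^ (s + b) * (4 ^ s / (2 * s)!)) * (6 * v) ^ r := by
      rw [hA]
      gcongr
    _ ≤ ρ ^ v / ρ ^ s * D ^ s / (4 ^ a * n ^ s) *
        (4 ^ a * 2 ^ s * (6 * v) ^ (s + b) * (4 ^ s / (2 * s)!)) * (6 * v) ^ r := by
      gcongr
    _ = (1728 * D / ρ / n * v) ^ s * ρ ^ v * ((v : ℝ) ^ (2 * s) / (2 * s)!) := by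
      have h3 : (6 * v : ℝ) ^ (s + b) * (6 * v) ^ r = 216 ^ s * (v ^ 2) ^ s * v ^ s := by
        rw [← pow_add, show s + b + r = 3 * s by omega, pow_mul, ← mul_pow, ← mul_pow]
        ring
      have h4 : (1728 * D / ρ / n * v) ^ s =
          2 ^ s * 4 ^ s * 216 ^ s * D ^ s / ρ ^ s / n ^ s * v ^ s := by
        rw [← mul_pow, ← mul_pow, mul_pow, div_pow, div_pow, mul_pow]
        norm_num
      calc _ = ρ ^ v / ρ ^ s * D ^ s / (4 ^ a * n ^ s) * (4 ^ a * 2 ^ s * (4 ^ s / (2 * s)!)) *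
            ((6 * v) ^ (s + b) * (6 * v) ^ r) := by ring
        _ = _ := by
          rw [h3, h4, pow_mul (v : ℝ)]
          generalize (2 * s)! = f
          field_simp
    _ ≤ (1728 * D / ρ / n * v) ^ s * ρ ^ v * (Real.exp (θ * v) / θ ^ (2 * s)) := by
      gcongr
    _ = t ^ s * (ρ * Real.exp θ) ^ v := by
      rw [mul_pow ρ, ← Real.exp_nat_mul, mul_comm (v : ℝ) θ, pow_mul θ 2 s, ht,
        show 1728 * D / (ρ * θ ^ 2) * v / n = 1728 * D / ρ / n * v / θ ^ 2 by field_simp,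
        div_pow _ (θ ^ 2)]
      ring
    _ ≤ t * (ρ * Real.exp θ) ^ v := by
      gcongr
      exact pow_le_of_le_one ht0 ht1 (by omega)

/-! ### Frequencies and monotonicity in the number of clauses -/

/-- The fraction of the elements of a finite type that have the property `P`. -/
noncomputable def freq {Ω : Type*} (P : Ω → Prop) : ℝ :=
  (Nat.card {ω : Ω // P ω} : ℝ) / (Nat.card Ω : ℝ)

section freq

variable {Ω : Type*} [Finite Ω] {P Q R : Ω → Prop}

theorem freq_mono (h : ∀ ω, P ω → Q ω) : freq P ≤ freq Q := by
  unfold freq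
  gcongr
  exact Nat.card_le_card_of_injective (Subtype.map id h) (Subtype.map_injective h fun _ _ => id)

theorem freq_le_one : freq P ≤ 1 :=
  div_le_one_of_le₀ (by exact_mod_cast Finite.card_subtype_le P) (Nat.cast_nonneg _)

theorem freq_exists_mem_le {ι : Type*} (s : Finset ι) (P : ι → Ω → Prop) :
    freq (fun ω => ∃ i ∈ s, P i ω) ≤ ∑ i ∈ s, freq (P i) := by
  classical
  have := Fintype.ofFinite Ω
  unfold freq
  rw [← Finset.sum_div]
  gcongr
  simp only [Nat.card_eq_fintype_card, Fintype.card_subtype]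
  have : (Finset.univ.filter fun ω => ∃ i ∈ s, P i ω) =
      s.biUnion fun i => Finset.univ.filter (P i) := by
    ext
    simp
  rw [this]
  exact_mod_cast Finset.card_biUnion_le

theorem one_le_freq_add_add [Nonempty Ω] (h : ∀ ω, P ω ∨ Q ω ∨ R ω) :
    1 ≤ freq P + freq Q + freq R := by
  classical
  have := Fintype.ofFinite Ω
  unfold freq
  rw [← add_div, ← add_div, one_le_div (by exact_mod_cast Nat.card_pos)]
  simp only [Nat.card_eq_fintype_card, Fintype.card_subtype]
  have hu : (Finset.univ : Finset Ω) =
      Finset.univ.filter P ∪ Finset.univ.filter Q ∪ Finset.univ.filter R := by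
    ext ω
    simpa [or_assoc] using h ω
  rw [← Finset.card_univ]
  conv_lhs => rw [hu]
  exact_mod_cast (Finset.card_union_le _ _).trans
    (Nat.add_le_add_right (Finset.card_union_le _ _) _)

end freq

theorem card_sample (n m₃ m₂ : ℕ) : Nat.card (Sample n m₃ m₂) =
    Nat.card (KClause n 3) ^ m₃ * Nat.card (KClause n 2) ^ m₂ := by
  simp [Nat.card_prod, Nat.card_fun]

theorem card_kClause_pos {n k : ℕ} (h : k ≤ n) : 0 < Nat.card (KClause n k) :=
  (mul_pos (by positivity) (Nat.choose_pos h)).trans_le (two_pow_mul_choose_le n k)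

theorem nonempty_sample {n : ℕ} (h : 3 ≤ n) (m₃ m₂ : ℕ) : Nonempty (Sample n m₃ m₂) := by
  have h3 : Nonempty (KClause n 3) := (Nat.card_pos_iff.1 (card_kClause_pos h)).1
  have h2 : Nonempty (KClause n 2) := (Nat.card_pos_iff.1 (card_kClause_pos (by omega))).1
  infer_instance

/-- An increasing property becomes more likely when clauses are added. -/
theorem freq_le_freq_of_le {n m₃ m₂ k₃ k₂ : ℕ} (hn : 3 ≤ n) (h3 : m₃ ≤ k₃) (h2 : m₂ ≤ k₂)
    {E : Formula n → Prop} (hE : ∀ F G, F ⊆ G → E F → E G) :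
    freq (fun ω : Sample n m₃ m₂ => E (sampleFormula ω)) ≤
      freq (fun ω : Sample n k₃ k₂ => E (sampleFormula ω)) := by
  obtain ⟨d₃, rfl⟩ := Nat.exists_eq_add_of_le h3
  obtain ⟨d₂, rfl⟩ := Nat.exists_eq_add_of_le h2
  have := nonempty_sample hn
  -- Coupling: the larger sample is the smaller one followed by independent further clauses.
  let φ : Sample n m₃ m₂ → Sample n d₃ d₂ → Sample n (m₃ + d₃) (m₂ + d₂) := fun ω ξ =>
    (Fin.append ω.1 ξ.1, Fin.append ω.2 ξ.2)
  have hφ : ∀ ω ξ, sampleFormula ω ⊆ sampleFormula (φ ω ξ) := by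
    intro ω ξ
    refine Finset.union_subset_union ?_ ?_
    · intro C hC
      obtain ⟨i, -, rfl⟩ := Finset.mem_image.1 hC
      exact Finset.mem_image.2 ⟨Fin.castAdd d₃ i, Finset.mem_univ _, by simp [φ]⟩
    · intro C hC
      obtain ⟨i, -, rfl⟩ := Finset.mem_image.1 hC
      exact Finset.mem_image.2 ⟨Fin.castAdd d₂ i, Finset.mem_univ _, by simp [φ]⟩
  have hinj : ∀ ω ξ ω' ξ', φ ω ξ = φ ω' ξ' → ω = ω' ∧ ξ = ξ' := by
    intro ω ξ ω' ξ' h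
    have e3 := (Fin.appendEquiv m₃ d₃).injective
      (show Fin.appendEquiv m₃ d₃ (ω.1, ξ.1) = Fin.appendEquiv m₃ d₃ (ω'.1, ξ'.1) from
        congrArg Prod.fst h)
    have e2 := (Fin.appendEquiv m₂ d₂).injective
      (show Fin.appendEquiv m₂ d₂ (ω.2, ξ.2) = Fin.appendEquiv m₂ d₂ (ω'.2, ξ'.2) from
        congrArg Prod.snd h)
    rw [Prod.mk.injEq] at e3 e2
    exact ⟨Prod.ext e3.1 e2.1, Prod.ext e3.2 e2.2⟩
  have hle : Nat.card {ω : Sample n m₃ m₂ // E (sampleFormula ω)} * Nat.card (Sample n d₃ d₂) ≤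
      Nat.card {ω : Sample n (m₃ + d₃) (m₂ + d₂) // E (sampleFormula ω)} := by
    rw [← Nat.card_prod]
    refine Nat.card_le_card_of_injective (fun q => ⟨φ q.1.1 q.2, hE _ _ (hφ _ _) q.1.2⟩) ?_
    rintro ⟨⟨ω, _⟩, ξ⟩ ⟨⟨ω', _⟩, ξ'⟩ h
    obtain ⟨rfl, rfl⟩ := hinj _ _ _ _ (Subtype.ext_iff.1 h)
    rfl
  have hcard : Nat.card (Sample n (m₃ + d₃) (m₂ + d₂)) =
      Nat.card (Sample n m₃ m₂) * Nat.card (Sample n d₃ d₂) := by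
    simp only [card_sample, pow_add]
    ring
  have hm : 0 < Nat.card (Sample n m₃ m₂) := Nat.card_pos
  have hd : 0 < Nat.card (Sample n d₃ d₂) := Nat.card_pos
  unfold freq
  rw [hcard, div_le_div_iff₀ (by exact_mod_cast hm) (by exact_mod_cast Nat.mul_pos hm hd)]
  calc _ = ((Nat.card {ω : Sample n m₃ m₂ // E (sampleFormula ω)} *
        Nat.card (Sample n d₃ d₂) : ℕ) : ℝ) * Nat.card (Sample n m₃ m₂) := by push_cast; ring
    _ ≤ _ := by gcongr

/-! ### Small covers are unlikely -/

/-- The probability that given positions cover exactly a given set of literals. -/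
theorem freq_covers_le {n m₃ m₂ : ℕ} (hn : 3 ≤ n) (B : Finset (Fin m₃)) (A : Finset (Fin m₂))
    (T : Finset (Literal n)) :
    freq (fun ω : Sample n m₃ m₂ => Covers ω B A T) ≤
      ((3 * B.card + 2 * A.card).descFactorial T.card : ℝ) *
        (T.card : ℝ) ^ (3 * B.card + 2 * A.card - T.card) *
        ((1 / (2 * Nat.card (KClause n 2) : ℝ)) ^ A.card *
          (1 / (6 * Nat.card (KClause n 3) : ℝ)) ^ B.card) := by
  have h := card_covers_mul_le B A T
  have hB : B.card ≤ m₃ := by simpa using Finset.card_le_univ B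
  have hA : A.card ≤ m₂ := by simpa using Finset.card_le_univ A
  have h3 := card_kClause_pos (n := n) (k := 3) hn
  have h2 := card_kClause_pos (n := n) (k := 2) (by omega)
  unfold freq
  rw [card_sample]
  generalize Nat.card (KClause n 3) = N₃ at *
  generalize Nat.card (KClause n 2) = N₂ at *
  have h3' : (0 : ℝ) < N₃ := by exact_mod_cast h3
  have h2' : (0 : ℝ) < N₂ := by exact_mod_cast h2
  have h' : (Nat.card {ω : Sample n m₃ m₂ // Covers ω B A T} : ℝ) *
      (6 ^ B.card * 2 ^ A.card) ≤
      (((3 * B.card + 2 * A.card).descFactorial T.card : ℝ) *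
        (T.card : ℝ) ^ (3 * B.card + 2 * A.card - T.card)) *
      ((N₃ : ℝ) ^ (m₃ - B.card) * (N₂ : ℝ) ^ (m₂ - A.card)) := by exact_mod_cast h
  have e3 : (N₃ : ℝ) ^ m₃ = N₃ ^ (m₃ - B.card) * N₃ ^ B.card := by
    rw [← pow_add, Nat.sub_add_cancel hB]
  have e2 : (N₂ : ℝ) ^ m₂ = N₂ ^ (m₂ - A.card) * N₂ ^ A.card := by
    rw [← pow_add, Nat.sub_add_cancel hA]
  push_cast
  rw [div_le_iff₀ (by positivity), e3, e2]
  rw [← le_div_iff₀ (by positivity)] at h'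
  refine h'.trans (le_of_eq ?_)
  simp only [one_div, inv_pow, mul_pow]
  field_simp

open scoped Nat in
/-- The first moment bound for coverings of `v` variables by `a` clauses of length 2 and `b`
clauses of length 3. -/
theorem freq_exists_covers_le {n m₃ m₂ : ℕ} (hn : 3 ≤ n) (v a b : ℕ) :
    freq (fun ω : Sample n m₃ m₂ => ∃ (V : Finset (Fin n)) (B : Finset (Fin m₃))
      (A : Finset (Fin m₂)), V.card = v ∧ B.card = b ∧ A.card = a ∧
        Covers ω B A (V ×ˢ Finset.univ)) ≤
      (n : ℝ) ^ v / v ! * (1 / (a ! * b !)) * (3 * b + 2 * a).descFactorial (2 * v) *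
        (2 * v : ℝ) ^ (3 * b + 2 * a - 2 * v) *
        ((m₂ / (2 * Nat.card (KClause n 2) : ℝ)) ^ a *
          (m₃ / (6 * Nat.card (KClause n 3) : ℝ)) ^ b) := by
  set S := Finset.powersetCard v (Finset.univ : Finset (Fin n)) ×ˢ
    Finset.powersetCard b (Finset.univ : Finset (Fin m₃)) ×ˢ
    Finset.powersetCard a (Finset.univ : Finset (Fin m₂)) with hS
  set X : ℝ := ((3 * b + 2 * a).descFactorial (2 * v) : ℝ) *
    (2 * v : ℝ) ^ (3 * b + 2 * a - 2 * v) * ((1 / (2 * Nat.card (KClause n 2) : ℝ)) ^ a *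
          (1 / (6 * Nat.card (KClause n 3) : ℝ)) ^ b) with hX
  have hX0 : 0 ≤ X := by positivity
  calc _ ≤ freq (fun ω : Sample n m₃ m₂ => ∃ q ∈ S, Covers ω q.2.1 q.2.2 (q.1 ×ˢ Finset.univ)) := by
        refine freq_mono ?_
        rintro ω ⟨V, B, A, hV, hB, hA, h⟩
        exact ⟨(V, B, A), by simp [hS, Finset.mem_powersetCard, hV, hB, hA], h⟩
    _ ≤ ∑ q ∈ S, X := by
        refine (freq_exists_mem_le S _).trans (Finset.sum_le_sum fun q hq => ?_)
        simp only [hS, Finset.mem_product, Finset.mem_powersetCard] at hq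
        obtain ⟨⟨-, hV⟩, ⟨-, hB⟩, -, hA⟩ := hq
        have hT : (q.1 ×ˢ (Finset.univ : Finset Bool)).card = 2 * v := by
          simp [hV, mul_comm]
        have := freq_covers_le hn q.2.1 q.2.2 (q.1 ×ˢ Finset.univ)
        rw [hT, hB, hA] at this
        push_cast at this
        exact this
    _ = (n.choose v : ℝ) * m₃.choose b * m₂.choose a * X := by
        simp [hS, mul_assoc]
    _ ≤ ((n : ℝ) ^ v / v !) * ((m₃ : ℝ) ^ b / b !) * ((m₂ : ℝ) ^ a / a !) * X := by
        gcongr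
        · exact Nat.choose_le_pow_div v n
        · exact Nat.choose_le_pow_div b m₃
        · exact Nat.choose_le_pow_div a m₂
    _ = _ := by
        rw [hX, div_pow, div_pow, div_pow, div_pow]
        ring

/-- There are at least 2n(n - 1) clauses of length 2; the slack between δ and ρ pays for replacing n
- 1 by n. -/
theorem div_two_mul_card_kClause_le {ρ δ : ℝ} {n m₂ : ℕ} (hn : 3 ≤ n) (hδ : δ * n ≤ ρ * (n - 1))
    (hm : (m₂ : ℝ) ≤ δ * n) (hρ : 0 ≤ ρ) :
    m₂ / (2 * Nat.card (KClause n 2) : ℝ) ≤ ρ / (4 * n) := by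
  have h2 := card_kClause_pos (n := n) (k := 2) (by omega)
  have h2' : (0 : ℝ) < Nat.card (KClause n 2) := by exact_mod_cast h2
  have hN : (4 : ℝ) * n.choose 2 ≤ Nat.card (KClause n 2) := by
    exact_mod_cast two_pow_mul_choose_le n 2
  rw [Nat.cast_choose_two] at hN
  have hn' : (0 : ℝ) < n := by positivity
  rw [div_le_div_iff₀ (by positivity) (by positivity)]
  calc (m₂ : ℝ) * (4 * n) ≤ ρ * (n - 1) * (4 * n) := by
        gcongr
        exact hm.trans hδ
    _ = ρ * (2 * (4 * (n * (n - 1) / 2))) := by ring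
    _ ≤ ρ * (2 * Nat.card (KClause n 2)) := by gcongr

theorem div_six_mul_card_kClause_le {D : ℝ} {n m₃ : ℕ} (hn : 3 ≤ n)
    (hm : (m₃ : ℝ) ≤ D * n) (hD : 0 ≤ D) :
    m₃ / (6 * Nat.card (KClause n 3) : ℝ) ≤ D / n ^ 2 := by
  have h3' : (0 : ℝ) < Nat.card (KClause n 3) := by exact_mod_cast card_kClause_pos hn
  have hN : (n : ℝ) ^ 3 ≤ 6 * Nat.card (KClause n 3) := by
    have h : n ^ 3 ≤ 6 * Nat.card (KClause n 3) := by
      refine le_trans ?_ (Nat.mul_le_mul_left 6 (two_pow_mul_choose_le n 3))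
      have h6 : 6 * (2 ^ 3 * n.choose 3) = 8 * n.descFactorial 3 := by
        rw [Nat.descFactorial_eq_factorial_mul_choose]
        simp [Nat.factorial]
        ring
      obtain ⟨k, rfl⟩ := Nat.exists_eq_add_of_le' hn
      rw [h6]
      simp only [Nat.descFactorial_succ, Nat.descFactorial_zero, Nat.sub_zero, mul_one,
        show k + 3 - 1 = k + 2 by omega, show k + 3 - 2 = k + 1 by omega]
      nlinarith [sq_nonneg k, Nat.zero_le (k ^ 3)]
    exact_mod_cast h
  have hn' : (0 : ℝ) < n := by positivity
  rw [div_le_div_iff₀ (by positivity) (by positivity)]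
  calc (m₃ : ℝ) * n ^ 2 ≤ D * n * n ^ 2 := by gcongr
    _ = D * n ^ 3 := by ring
    _ ≤ _ := by gcongr

/-- Random instances whose 2-clause density is below 1 are unlikely to cover a small set of
variables by more clauses than variables. -/
theorem freq_exists_small_cover_le {ρ θ D δ : ℝ} (hρ : 0 < ρ) (hρ1 : ρ ≤ 1) (hθ : 0 < θ)
    (hq : ρ * Real.exp θ < 1) (hD : 1 ≤ D) {n m₃ m₂ : ℕ} (hn : 3 ≤ n)
    (hδ : δ * n ≤ ρ * (n - 1)) (hm₂ : (m₂ : ℝ) ≤ δ * n) (hm₃ : (m₃ : ℝ) ≤ D * n) :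
    freq (fun ω : Sample n m₃ m₂ => ∃ (V : Finset (Fin n)) (B : Finset (Fin m₃))
      (A : Finset (Fin m₂)), 1728 * D / (ρ * θ ^ 2) * V.card ≤ n ∧
        V.card + 1 ≤ B.card + A.card ∧ B.card + A.card ≤ 2 * V.card ∧
        Covers ω B A (V ×ˢ Finset.univ)) ≤
      (∑' v : ℕ, (2 * v + 1 : ℝ) ^ 2 *
        (1728 * D / (ρ * θ ^ 2) * v * (ρ * Real.exp θ) ^ v)) / n := by
  set K := 1728 * D / (ρ * θ ^ 2) with hK
  set q := ρ * Real.exp θ with hqdef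
  have hK0 : 0 ≤ K := by positivity
  have hq0 : 0 ≤ q := by positivity
  have hn' : (0 : ℝ) < n := by positivity
  have hsum : Summable fun v : ℕ => (2 * v + 1 : ℝ) ^ 2 * (K * v * q ^ v) := by
    have h : ∀ k : ℕ, Summable fun v : ℕ => (v : ℝ) ^ k * q ^ v := fun k =>
      summable_pow_mul_geometric_of_norm_lt_one k (by rwa [Real.norm_of_nonneg hq0])
    refine ((((h 3).mul_left (4 * K)).add ((h 2).mul_left (4 * K))).add
      ((h 1).mul_left K)).congr fun v => ?_
    ring
  set S := (Finset.range (n + 1)).sigma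
    fun v => Finset.range (2 * v + 1) ×ˢ Finset.range (2 * v + 1) with hS
  set S' := S.filter fun i => K * i.1 ≤ n ∧ i.1 + 1 ≤ i.2.1 + i.2.2 ∧ i.2.1 + i.2.2 ≤ 2 * i.1
    with hS'
  calc _ ≤ freq (fun ω : Sample n m₃ m₂ => ∃ i ∈ S', ∃ (V : Finset (Fin n))
          (B : Finset (Fin m₃)) (A : Finset (Fin m₂)), V.card = i.1 ∧ B.card = i.2.1 ∧
          A.card = i.2.2 ∧ Covers ω B A (V ×ˢ Finset.univ)) := by
        refine freq_mono ?_
        rintro ω ⟨V, B, A, h1, h2, h3, h⟩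
        refine ⟨⟨V.card, B.card, A.card⟩, ?_, V, B, A, rfl, rfl, rfl, h⟩
        have hV : V.card ≤ n := by simpa using Finset.card_le_univ V
        simp only [hS', hS, Finset.mem_filter, Finset.mem_sigma, Finset.mem_product,
          Finset.mem_range]
        exact ⟨⟨by omega, by omega, by omega⟩, h1, h2, h3⟩
    _ ≤ ∑ i ∈ S', K * i.1 / n * q ^ i.1 := by
        refine (freq_exists_mem_le S' _).trans (Finset.sum_le_sum fun i hi => ?_)
        obtain ⟨-, h1, h2, h3⟩ := Finset.mem_filter.1 hi
        refine (freq_exists_covers_le hn _ _ _).trans ?_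
        refine le_trans ?_ (first_moment_term_le hρ hρ1 hθ hD (by omega) h2 h3 h1)
        have e2 := div_two_mul_card_kClause_le hn hδ hm₂ hρ.le
        have e3 := div_six_mul_card_kClause_le hn hm₃ (zero_le_one.trans hD)
        exact mul_le_mul_of_nonneg_left (mul_le_mul (pow_le_pow_left₀ (by positivity) e2 _)
          (pow_le_pow_left₀ (by positivity) e3 _) (by positivity) (by positivity)) (by positivity)
    -- The summand no longer depends on a and b, so the restrictions can be dropped; each v then
    -- counts (2v + 1)² times.
    _ ≤ ∑ i ∈ S, K * i.1 / n * q ^ i.1 :=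
        Finset.sum_le_sum_of_subset_of_nonneg (Finset.filter_subset _ _)
          fun i _ _ => by positivity
    _ = (∑ v ∈ Finset.range (n + 1), (2 * v + 1 : ℝ) ^ 2 * (K * v * q ^ v)) / n := by
        rw [hS, Finset.sum_sigma, Finset.sum_div]
        refine Finset.sum_congr rfl fun v _ => ?_
        simp only [Finset.sum_const, Finset.card_product, Finset.card_range, nsmul_eq_mul]
        push_cast
        ring
    _ ≤ _ := by
        gcongr
        exact hsum.sum_le_tsum _ fun v _ => by positivity

/-! ### The phase transition -/

theorem isConstraint_of_mem_sampleFormula {p c : ℝ} (hp : p ∈ Set.Icc (0 : ℝ) 1) {n : ℕ}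
    {ω : Sample n ⌊p * c * n⌋₊ ⌊(1 - p) * c * n⌋₊} {C : Clause n} (hC : C ∈ sampleFormula ω) :
    IsConstraint p C := by
  rcases Finset.mem_union.1 hC with h | h
  · obtain ⟨i, -, rfl⟩ := Finset.mem_image.1 h
    refine Or.inr ⟨hp.1.lt_of_ne ?_, (ω.1 i).2⟩
    rintro rfl
    -- For p = 0 no clauses of length 3 are drawn, so the index type is empty.
    have := i.2
    simp at this
  · obtain ⟨i, -, rfl⟩ := Finset.mem_image.1 h
    refine Or.inl ⟨hp.2.lt_of_ne ?_, (ω.2 i).2⟩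
    rintro rfl
    have := i.2
    simp at this

theorem prob_mono_of_le {p c d : ℝ} (hp : p ∈ Set.Icc (0 : ℝ) 1) (hcd : c ≤ d) {n : ℕ}
    (hn : 3 ≤ n) {E : Formula n → Prop} (hE : ∀ F G, F ⊆ G → E F → E G) :
    prob p c n E ≤ prob p d n E := by
  have h1 : 0 ≤ 1 - p := by linarith [hp.2]
  have h0 := hp.1
  exact freq_le_freq_of_le hn (Nat.floor_mono (by gcongr)) (Nat.floor_mono (by gcongr)) hE

/-- An instance is satisfiable, or has a large spine, or covers a small set of variables. -/
theorem one_le_prob_spine_add {p c K : ℝ} (hp : p ∈ Set.Icc (0 : ℝ) 1) (hK : 0 < K) {n : ℕ}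
    (hn : 3 ≤ n) :
    1 ≤ prob p c n (fun Φ => 1 / K ≤ ((spine p Φ).ncard : ℝ) / n) + prob p c n Satisfiable +
      freq (fun ω : Sample n ⌊p * c * n⌋₊ ⌊(1 - p) * c * n⌋₊ => ∃ (V : Finset (Fin n))
        (B : Finset (Fin _)) (A : Finset (Fin _)), K * V.card ≤ n ∧
        V.card + 1 ≤ B.card + A.card ∧ B.card + A.card ≤ 2 * V.card ∧
        Covers ω B A (V ×ˢ Finset.univ)) := by
  have := nonempty_sample hn ⌊p * c * n⌋₊ ⌊(1 - p) * c * n⌋₊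
  refine one_le_freq_add_add fun ω => ?_
  by_cases hsat : Satisfiable (sampleFormula ω)
  · exact Or.inr (Or.inl hsat)
  obtain ⟨F, hFω, hF⟩ := exists_minimalUnsat_subset hsat
  obtain ⟨V, B, A, hVF, h1, h2, hcov⟩ := exists_covers_of_minimalUnsat hF hFω
  by_cases hV : K * V.card ≤ n
  · exact Or.inr (Or.inr ⟨V, B, A, hV, h1, h2, hcov⟩)
  left
  have hle : V.card ≤ (spine p (sampleFormula ω)).ncard := by
    rw [← Set.ncard_coe_finset, hVF]
    exact Set.ncard_le_ncard (hF.formulaVars_subset_spine hFω fun C hC =>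
      isConstraint_of_mem_sampleFormula hp hC) (Set.toFinite _)
  have hle' : (V.card : ℝ) ≤ (spine p (sampleFormula ω)).ncard := by exact_mod_cast hle
  have hn' : (0 : ℝ) < n := by positivity
  refine (div_le_div_iff₀ hK hn').2 ?_
  have := mul_le_mul_of_nonneg_left hle' hK.le
  linarith

end TwoPlusPSat

theorem mainTheorem6 (p : ℝ) (hp : p ∈ Set.Icc (0 : ℝ) 1) (ε : ℝ) (hε : 0 < ε)
    (c : ℝ) (hc : c * (1 - p) < 1 - ε)
    (hunsat : Filter.Tendsto (fun n : ℕ => TwoPlusPSat.prob p c n TwoPlusPSat.Satisfiable)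
      Filter.atTop (nhds 0)) :
    TwoPlusPSat.HasFirstOrderPhaseTransition p := by
  open TwoPlusPSat in
  have hp0 := hp.1
  have hp1 : 0 ≤ 1 - p := by linarith [hp.2]
  -- The maximum with 1/2 keeps δ positive even if ε ≥ 1.
  obtain ⟨δ, hδ0, hδ1, hcδ⟩ : ∃ δ : ℝ, 0 < δ ∧ δ < 1 ∧ c * (1 - p) ≤ δ :=
    ⟨max (1 / 2) (1 - ε), by positivity, max_lt (by norm_num) (by linarith),
      hc.le.trans (le_max_right _ _)⟩
  obtain ⟨ρ, hδρ, hρ1⟩ := exists_between hδ1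
  have hρ0 : 0 < ρ := hδ0.trans hδρ
  obtain ⟨θ, hθ, hq⟩ : ∃ θ : ℝ, 0 < θ ∧ ρ * Real.exp θ < 1 := by
    have hlog := Real.log_neg hρ0 hρ1
    -- With this θ, ρ e^θ is the square root of ρ.
    refine ⟨-Real.log ρ / 2, by linarith, ?_⟩
    nth_rewrite 1 [← Real.exp_log hρ0]
    rw [← Real.exp_add, Real.exp_lt_one_iff]
    linarith
  set D : ℝ := |c| + 1 with hD
  have hD1 : 1 ≤ D := by linarith [abs_nonneg c]
  set K : ℝ := 1728 * D / (ρ * θ ^ 2) with hK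
  have hK0 : 0 < K := by positivity
  refine ⟨1 / K, by positivity, fun d hd => ?_⟩
  set M : ℝ := ∑' v : ℕ, (2 * v + 1 : ℝ) ^ 2 * (K * v * (ρ * Real.exp θ) ^ v) with hM
  have hlow : Tendsto (fun n : ℕ => 1 - (prob p (d n) n Satisfiable + prob p c n Satisfiable +
      M / n)) atTop (𝓝 1) := by
    simpa using tendsto_const_nhds.sub
      ((hd.add hunsat).add (tendsto_const_div_atTop_nhds_zero_nat M))
  have hρn : ∀ᶠ n : ℕ in atTop, δ * n ≤ ρ * (n - 1) := by
    filter_upwards [eventually_ge_atTop ⌈ρ / (ρ - δ)⌉₊] with n hn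
    have := (Nat.le_ceil _).trans (Nat.cast_le.2 hn : ((_ : ℕ) : ℝ) ≤ n)
    rw [div_le_iff₀ (by linarith)] at this
    linarith
  refine tendsto_of_tendsto_of_tendsto_of_le_of_le' hlow tendsto_const_nhds ?_
    (Eventually.of_forall fun n => freq_le_one)
  filter_upwards [hρn, eventually_ge_atTop 3] with n hδn hn
  -- At density min(d(n), c) both clause counts are controlled by `c` alone, whatever d(n) is.
  have hm₂ : ((⌊(1 - p) * min (d n) c * n⌋₊ : ℕ) : ℝ) ≤ δ * n := by
    refine (Nat.cast_le.2 (Nat.floor_mono ?_)).trans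
      (Nat.floor_le (by positivity : 0 ≤ δ * (n : ℝ)))
    gcongr
    refine le_trans ?_ hcδ
    rw [mul_comm c]
    gcongr
    exact min_le_right _ _
  have hm₃ : ((⌊p * min (d n) c * n⌋₊ : ℕ) : ℝ) ≤ D * n := by
    refine (Nat.cast_le.2 (Nat.floor_mono ?_)).trans
      (Nat.floor_le (by positivity : 0 ≤ D * (n : ℝ)))
    gcongr
    calc p * min (d n) c ≤ p * |c| := by
          gcongr
          exact (min_le_right _ _).trans (le_abs_self c)
      _ ≤ 1 * |c| := by
          gcongr
          exact hp.2
      _ ≤ D := by linarith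
  have hbad := freq_exists_small_cover_le hρ0 hρ1.le hθ hq hD1 hn hδn hm₂ hm₃
  have hone := one_le_prob_spine_add (c := min (d n) c) hp hK0 hn
  have hmono : prob p (min (d n) c) n (fun Φ => 1 / K ≤ ((spine p Φ).ncard : ℝ) / n) ≤
      prob p (d n) n (fun Φ => 1 / K ≤ ((spine p Φ).ncard : ℝ) / n) := by
    refine prob_mono_of_le hp (min_le_left _ _) hn fun F G hFG hF => hF.trans ?_
    gcongr
    · exact Set.toFinite _
    · exact spine_mono p hFG
  -- The minimum is one of the two densities, and satisfiability is unlikely at both.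
  have hsat : prob p (min (d n) c) n Satisfiable ≤
      prob p (d n) n Satisfiable + prob p c n Satisfiable := by
    have h0 : ∀ c', 0 ≤ prob p c' n Satisfiable := fun c' => by
      unfold prob
      positivity
    rcases min_choice (d n) c with h | h <;> rw [h] <;> linarith [h0 c, h0 (d n)]
  linarith
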